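/- Let $(\mathcal{R},g)$ be an oriented, connected, smooth Riemannian $3$-manifold with (possibly empty) boundary; no completeness is assumed. For a smooth vector field $Y$ on $\mathcal{R}$ let $\omega^1_Y=g(Y,\cdot)$, let $\mathrm{curl}(Y)$ be the vector field with $\omega^1_{\mathrm{curl}(Y)}=\star d\omega^1_Y$, where $\star$ is the Hodge star of $g$ and the orientation, and say that $Y$ satisfies the Killing equations if $g(\nabla_X Y,Z)+g(X,\nabla_Z Y)=0$ for all tangent vectors $X,Z$ at a common point, where $\nabla$ is the Levi-Civita connection. Suppose that $Y_1,Y_2$ are two smooth vector fields on $\mathcal{R}$ which satisfy the Killing equations, and that there is a constant $\lambda\in\mathbb{R}$ (possibly zero) with $\mathrm{curl}(Y_i)=\lambda Y_i$ on $\mathcal{R}$ for $i=1,2$. If $Y_1(p)$ and $Y_2(p)$ are linearly independent (equivalently, $Y_1(p)\times Y_2(p)\neq 0$) at some point $p\in\mathcal{R}$, then $(\mathcal{R},g)$ has constant sectional curvature $\lambda^2/4$, that is, at every point of $\mathcal{R}$ every $2$-dimensional subspace of the tangent space has sectional curvature $\lambda^2/4$. -/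

import Mathlib

open Set Module
open scoped Manifold ContDiff Topology Bundle

noncomputable section

namespace KillingBeltrami

/-! ### Riemannian geometry in a coordinate domain

`s : Set E` is the coordinate half-space (or all of `E`), and `G y` is the metric at the point with
coordinates `y`, as a bilinear form on `E`. -/

section Coordinates

variable {E : Type*} [NormedAddCommGroup E] [NormedSpace ℝ E]

/-- The Christoffel symbols `Γ(u, v)` of the Levi-Civita connection of `G`: the vector determined by
`G(Γ(u, v), w) = 1/2 * ((∂_u G)(v, w) + (∂_v G)(u, w) - (∂_w G)(u, v))` for all `w`. Here
`(G y).inverse` raises the index. -/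
def christoffel (s : Set E) (G : E → E →L[ℝ] E →L[ℝ] ℝ) (y u v : E) : E :=
  (G y).inverse ((1 / 2 : ℝ) •
    (fderivWithin ℝ G s y u v + fderivWithin ℝ G s y v u
      - ((fderivWithin ℝ G s y).flip u).flip v))

/-- The Levi-Civita covariant derivative `∇_u V` at `y` of the vector field `V`. -/
def covDeriv (s : Set E) (G : E → E →L[ℝ] E →L[ℝ] ℝ) (V : E → E) (y u : E) : E :=
  fderivWithin ℝ V s y u + christoffel s G y u (V y)

/-- The Riemann curvature `R(u, v) w = ∇_u ∇_v w - ∇_v ∇_u w` at `y`, where `u`, `v`, `w` are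
extended to constant vector fields of the coordinate domain (so that `[u, v] = 0`). -/
def riemann (s : Set E) (G : E → E →L[ℝ] E →L[ℝ] ℝ) (y u v w : E) : E :=
  covDeriv s G (fun z ↦ christoffel s G z v w) y u
    - covDeriv s G (fun z ↦ christoffel s G z u w) y v

/-- The sectional curvature `G(R(u, v) v, u) / |u ∧ v|²` of the plane spanned by `u` and `v`. -/
def sec (s : Set E) (G : E → E →L[ℝ] E →L[ℝ] ℝ) (y u v : E) : ℝ :=
  G y (riemann s G y u v v) u / (G y u u * G y v v - G y u v ^ 2)

end Coordinates

/-! ### The Hodge star -/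

section HodgeStar

variable {V : Type*} [NormedAddCommGroup V] [InnerProductSpace ℝ V] [FiniteDimensional ℝ V]
  [Fact (finrank ℝ V = 3)]

/-- The Hodge star of a 2-form `β` on an oriented 3-dimensional Euclidean space, that is the 1-form
`⋆β = ∑_{i < j} β(e_i, e_j) vol(e_i, e_j, ·)` for any orthonormal basis `e`. -/
def hodgeStar (o : Orientation ℝ V (Fin 3)) (β : V [⋀^Fin 2]→L[ℝ] ℝ) (v : V) : ℝ :=
  let e := stdOrthonormalBasis ℝ V
  (1 / 2 : ℝ) * ∑ i, ∑ j, β ![e i, e j] * o.volumeForm ![e i, e j, v]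

/-- The vector `α♯` with `⟪α♯, v⟫ = α v` for a linear functional `α`. -/
def sharp (α : V → ℝ) : V :=
  let e := stdOrthonormalBasis ℝ V
  ∑ k, α (e k) • e k

end HodgeStar

/-! ### Riemannian manifolds

Points of `M` are denoted `x`, and `x₀` selects the chart `extChartAt I x₀`. All the tensors below
may be computed in any chart whose domain contains `x`, with the same result. -/

section Manifold

variable {E : Type*} [NormedAddCommGroup E] [NormedSpace ℝ E]
  {H : Type*} [TopologicalSpace H] (I : ModelWithCorners ℝ E H)
  {M : Type*} [TopologicalSpace M] [ChartedSpace H M]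

/-- The linear map sending a coordinate vector at `y` to the corresponding tangent vector: the
derivative of the inverse of the chart at `x₀`. -/
def chartSymmDeriv (x₀ : M) (y : E) : E →L[ℝ] TangentSpace I ((extChartAt I x₀).symm y) :=
  mfderivWithin 𝓘(ℝ, E) I (extChartAt I x₀).symm (range I) y

/-- The coordinate vector of the tangent vector `X` at `x` in the chart at `x₀`. -/
def toCoord (x₀ : M) (x : M) : TangentSpace I x →L[ℝ] E :=
  mfderiv I 𝓘(ℝ, E) (extChartAt I x₀) x

/-- The vector field `Y` in the chart at `x₀`. -/
def fieldInChart (x₀ : M) (Y : Π x : M, TangentSpace I x) (y : E) : E :=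
  VectorField.mpullbackWithin 𝓘(ℝ, E) I (extChartAt I x₀).symm Y (range I) y

/-- `o` is an orientation of the manifold: in a chart around each point it is constant. -/
def IsOrientation (o : Π x : M, Orientation ℝ (TangentSpace I x) (Fin 3)) : Prop :=
  ∀ x₀ : M, ∃ o₀ : Orientation ℝ E (Fin 3), ∀ᶠ x in 𝓝 x₀,
    ∃ L : TangentSpace I x ≃ₗ[ℝ] E, (∀ X, L X = toCoord I x₀ x X) ∧
      Orientation.map (Fin 3) L (o x) = o₀

instance instFactFinrank [hE : Fact (finrank ℝ E = 3)] (x : M) :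
    Fact (finrank ℝ (TangentSpace I x) = 3) := hE

instance instFiniteDimensional [hE : Fact (finrank ℝ E = 3)] (x : M) :
    FiniteDimensional ℝ (TangentSpace I x) :=
  haveI : FiniteDimensional ℝ E := Module.finite_of_finrank_eq_succ (n := 2) hE.out
  inferInstanceAs (FiniteDimensional ℝ E)

variable [Bundle.RiemannianBundle (fun x : M ↦ TangentSpace I x)]

/-- The Riemannian metric in the chart at `x₀`. -/
def metricInChart (x₀ : M) (y : E) : E →L[ℝ] E →L[ℝ] ℝ :=
  (innerSL ℝ (E := TangentSpace I ((extChartAt I x₀).symm y))).bilinearComp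
    (chartSymmDeriv I x₀ y) (chartSymmDeriv I x₀ y)

/-- The Killing equations `g(∇_u Y, w) + g(u, ∇_w Y) = 0`. -/
def IsKilling (Y : Π x : M, TangentSpace I x) : Prop :=
  ∀ x₀ : M, ∀ x ∈ (chartAt H x₀).source, ∀ u w : E,
    let y := extChartAt I x₀ x
    let G := metricInChart I x₀
    let nabla := covDeriv (range I) G (fieldInChart I x₀ Y) y
    G y (nabla u) w + G y u (nabla w) = 0

/-- The 1-form `Y♭ = g(Y, ·)` in the chart at `x₀`. -/
def flatInChart (x₀ : M) (Y : Π x : M, TangentSpace I x) (y : E) : E [⋀^Fin 1]→L[ℝ] ℝ :=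
  ContinuousAlternatingMap.ofSubsingleton ℝ E ℝ (0 : Fin 1)
    (metricInChart I x₀ y (fieldInChart I x₀ Y y))

/-- The 2-form `d(Y♭)` at `x`, computed in the chart at `x₀`. -/
def dFlat (x₀ : M) (Y : Π x : M, TangentSpace I x) (x : M) :
    (TangentSpace I x) [⋀^Fin 2]→L[ℝ] ℝ :=
  (extDerivWithin (flatInChart I x₀ Y) (range I) (extChartAt I x₀ x)).compContinuousLinearMap
    (toCoord I x₀ x)

/-- Sectional curvature at `x` of the plane spanned by `X` and `Z`, computed in the chart at
`x₀`. -/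
def sectionalCurvature (x₀ x : M) (X Z : TangentSpace I x) : ℝ :=
  sec (range I) (metricInChart I x₀) (extChartAt I x₀ x) (toCoord I x₀ x X) (toCoord I x₀ x Z)

variable (M) in
/-- All sectional curvatures of `M` are equal to `c`. -/
def HasConstantSectionalCurvature (c : ℝ) : Prop :=
  ∀ x₀ : M, ∀ x ∈ (chartAt H x₀).source, ∀ X Z : TangentSpace I x,
    LinearIndependent ℝ ![X, Z] → sectionalCurvature I x₀ x X Z = c

variable [Fact (finrank ℝ E = 3)]

/-- The curl of `Y` at `x`, i.e. `(⋆ d(Y♭))♯`, computed in the chart at `x₀`. -/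
def curl (o : Π x : M, Orientation ℝ (TangentSpace I x) (Fin 3)) (x₀ : M)
    (Y : Π x : M, TangentSpace I x) (x : M) : TangentSpace I x :=
  sharp (hodgeStar (o x) (dFlat I x₀ Y x))

/-- `curl Y = l Y` on `M`. -/
def IsCurlEigenfield (o : Π x : M, Orientation ℝ (TangentSpace I x) (Fin 3))
    (Y : Π x : M, TangentSpace I x) (l : ℝ) : Prop :=
  ∀ x₀ : M, ∀ x ∈ (chartAt H x₀).source, curl I o x₀ Y x = l • Y x

end Manifold

end KillingBeltrami

end

/-!
Write `×` for the cross product of the metric `g` and the orientation, taken pointwise. For a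
Killing field `Y` the 2-form `d(Y♭)` is `2 g(∇Y, ·)`, so `curl Y = l Y` says exactly that
`∇_u Y = c Y × u` with `c = l / 2` (`isCrossField_fieldInChart`). This condition is linear in `Y`,
and it has three consequences for fields `Y`, `Z` satisfying it.

* `g(Y, Z)` is constant, because `u ↦ Y × u` is skew (`isLocallyConstant_inner`). Hence `Y₁` and
  `Y₂`, being independent at one point of the connected manifold, are independent everywhere.
* `∇_Y Y = 0`, and `|∇_u Y|² = c² (|Y|² |u|² - g(Y, u)²)`.
* `g(R(u, Y) Y, u) = |∇_u Y|²` (`metric_riemann_eq_metric_covDeriv`). In the commutator of second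
  covariant derivatives, differentiating `g(∇_u Y, u) = 0` along `Y` removes one term, and
  differentiating `∇_Y Y = 0` along `u` expresses the other as `-g(∇_{∇_u Y} Y, u)`, which is
  `|∇_u Y|²`.

So every plane containing a nonzero value of a field `a Y₁ + b Y₂` has sectional curvature `c²`. At
each point these values fill a plane, which in dimension three meets every other plane; since
sectional curvature depends on the plane only (`metric_riemann_change_basis`), the theorem follows
(`sec_eq_of_isCrossField`).

Everything is computed in a chart, with derivatives within the coordinate half-space. The cross
product enters only algebraically and is never differentiated, so the orientation matters only
pointwise.
-/

-- Iterated spaces of continuous linear maps need a deeper instance search than the default one.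
set_option maxSynthPendingDepth 3

/-! ### The Hodge star in dimension three -/

section Pointwise

variable {V : Type*} [NormedAddCommGroup V] [InnerProductSpace ℝ V] [Fact (finrank ℝ V = 3)]

/-- In an orthonormal basis the volume form is, up to a global sign, the determinant of the
coordinates. -/
lemma exists_volumeForm_eq_coordinates (o : Orientation ℝ V (Fin 3))
    (e : OrthonormalBasis (Fin 3) ℝ V) :
    ∃ ε : ℝ, ε * ε = 1 ∧ ∀ a b c : V, o.volumeForm ![a, b, c] = ε *
      (inner ℝ (e 0) a * (inner ℝ (e 1) b * inner ℝ (e 2) c - inner ℝ (e 2) b * inner ℝ (e 1) c)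
      - inner ℝ (e 1) a * (inner ℝ (e 0) b * inner ℝ (e 2) c - inner ℝ (e 2) b * inner ℝ (e 0) c)
      + inner ℝ (e 2) a *
        (inner ℝ (e 0) b * inner ℝ (e 1) c - inner ℝ (e 1) b * inner ℝ (e 0) c)) := by
  have hdet : ∀ a b c : V, e.toBasis.det ![a, b, c] =
      (inner ℝ (e 0) a * (inner ℝ (e 1) b * inner ℝ (e 2) c - inner ℝ (e 2) b * inner ℝ (e 1) c)
      - inner ℝ (e 1) a * (inner ℝ (e 0) b * inner ℝ (e 2) c - inner ℝ (e 2) b * inner ℝ (e 0) c)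
      + inner ℝ (e 2) a *
        (inner ℝ (e 0) b * inner ℝ (e 1) c - inner ℝ (e 1) b * inner ℝ (e 0) c)) := by
    intro a b c
    rw [Basis.det_apply, Matrix.det_fin_three]
    simp [Basis.toMatrix_apply, OrthonormalBasis.repr_apply_apply]
    ring
  by_cases h : e.toBasis.orientation = o
  · exact ⟨1, by norm_num, fun a b c ↦ by rw [o.volumeForm_robust e h, hdet, one_mul]⟩
  · refine ⟨-1, by norm_num, fun a b c ↦ ?_⟩
    rw [o.volumeForm_robust_neg e h, AlternatingMap.neg_apply, hdet]
    ring

/-- If `c vol(a, b, ·)` is the functional `⟪n, ·⟫`, then `n = c a × b`, so that its length is given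
by Lagrange's identity. -/
lemma inner_self_of_inner_eq_volumeForm (o : Orientation ℝ V (Fin 3)) {c : ℝ} {a b n : V}
    (h : ∀ v, inner ℝ n v = c * o.volumeForm ![a, b, v]) :
    inner ℝ n n = c ^ 2 * (inner ℝ a a * inner ℝ b b - inner ℝ a b ^ 2) := by
  have : FiniteDimensional ℝ V := .of_fact_finrank_eq_succ 2
  let e : OrthonormalBasis (Fin 3) ℝ V :=
    (stdOrthonormalBasis ℝ V).reindex (finCongr Fact.out)
  obtain ⟨ε, hε, hvol⟩ := exists_volumeForm_eq_coordinates o e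
  have key : ∀ x y : V, inner ℝ x y = inner ℝ (e 0) x * inner ℝ (e 0) y +
      inner ℝ (e 1) x * inner ℝ (e 1) y + inner ℝ (e 2) x * inner ℝ (e 2) y := by
    intro x y
    rw [← e.sum_inner_mul_inner x y, Fin.sum_univ_three]
    simp only [real_inner_comm]
  have he : ∀ i, inner ℝ (e i) (e i) = (1 : ℝ) := fun i ↦ by simp
  have he' : ∀ i j, i ≠ j → inner ℝ (e i) (e j) = (0 : ℝ) := fun i j hij ↦ e.orthonormal.2 hij
  have e01 := he' 0 1 (by decide)
  have e02 := he' 0 2 (by decide)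
  have e10 := he' 1 0 (by decide)
  have e12 := he' 1 2 (by decide)
  have e20 := he' 2 0 (by decide)
  have e21 := he' 2 1 (by decide)
  have h0 := h (e 0)
  have h1 := h (e 1)
  have h2 := h (e 2)
  rw [hvol, real_inner_comm] at h0 h1 h2
  simp only [he, e01, e02, e10, e12, e20, e21] at h0 h1 h2
  rw [key n n, key a a, key b b, key a b, h0, h1, h2]
  linear_combination (c ^ 2 * ((inner ℝ (e 0) a * inner ℝ (e 1) b
    - inner ℝ (e 1) a * inner ℝ (e 0) b) ^ 2 + (inner ℝ (e 0) a * inner ℝ (e 2) b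
    - inner ℝ (e 2) a * inner ℝ (e 0) b) ^ 2 + (inner ℝ (e 1) a * inner ℝ (e 2) b
    - inner ℝ (e 2) a * inner ℝ (e 1) b) ^ 2)) * hε

variable [FiniteDimensional ℝ V]

/-- The Hodge star is injective on 2-forms: if `⋆β` is the functional `⟪l • Y, ·⟫`, then
`β = l vol(Y, ·, ·)`. -/
lemma eq_volumeForm_of_sharp_hodgeStar_eq (o : Orientation ℝ V (Fin 3))
    (β : V [⋀^Fin 2]→L[ℝ] ℝ) (Y : V) (l : ℝ)
    (h : KillingBeltrami.sharp (KillingBeltrami.hodgeStar o β) = l • Y) (a b : V) :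
    β ![a, b] = l * o.volumeForm ![Y, a, b] := by
  let e : OrthonormalBasis (Fin 3) ℝ V :=
    (stdOrthonormalBasis ℝ V).reindex (finCongr Fact.out)
  obtain ⟨ε, hε, hvol⟩ := exists_volumeForm_eq_coordinates o e
  have he : ∀ i, inner ℝ (e i) (e i) = (1 : ℝ) := fun i ↦ by simp
  have he' : ∀ i j, i ≠ j → inner ℝ (e i) (e j) = (0 : ℝ) := fun i j hij ↦ e.orthonormal.2 hij
  have e01 := he' 0 1 (by decide)
  have e02 := he' 0 2 (by decide)
  have e10 := he' 1 0 (by decide)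
  have e12 := he' 1 2 (by decide)
  have e20 := he' 2 0 (by decide)
  have e21 := he' 2 1 (by decide)
  have hstar : ∀ v, KillingBeltrami.hodgeStar o β v =
      (1 / 2 : ℝ) * ∑ i, ∑ j, β ![e i, e j] * o.volumeForm ![e i, e j, v] := by
    intro v
    have hd : finrank ℝ V = 3 := Fact.out
    simp only [KillingBeltrami.hodgeStar]
    congr 1
    refine Fintype.sum_equiv (finCongr hd) _ _ fun i ↦
      Fintype.sum_equiv (finCongr hd) _ _ fun j ↦ ?_
    simp [e]
  have hsharp : ∀ k, l * inner ℝ (e k) Y = KillingBeltrami.hodgeStar o β (e k) := by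
    intro k
    have hd : finrank ℝ V = 3 := Fact.out
    have hk : e k = stdOrthonormalBasis ℝ V ((finCongr hd).symm k) := by simp [e]
    rw [← real_inner_smul_right, ← h, hk]
    simp only [KillingBeltrami.sharp]
    exact (stdOrthonormalBasis ℝ V).orthonormal.inner_right_fintype _ _
  have hswap : ∀ x y : V, β ![x, y] = - β ![y, x] := by
    intro x y
    have := β.toAlternatingMap.map_swap ![y, x] (i := 0) (j := 1) (by decide)
    rw [← ContinuousAlternatingMap.coe_toAlternatingMap, ← this]
    congr 1
    ext i; fin_cases i <;> rfl
  have hzero : ∀ x : V, β ![x, x] = 0 := fun x ↦ by linarith [hswap x x]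
  have hext : β.toAlternatingMap = l • o.volumeForm.curryLeft Y := by
    refine e.toBasis.ext_alternating fun v _ ↦ ?_
    have hv : (fun i ↦ e.toBasis (v i)) = ![e (v 0), e (v 1)] := by
      ext i; fin_cases i <;> simp
    rw [hv]
    have h0 := hsharp 0
    have h1 := hsharp 1
    have h2 := hsharp 2
    rw [hstar] at h0 h1 h2
    simp only [hvol, Fin.sum_univ_three, he, e01, e02, e10, e12, e20, e21, hzero] at h0 h1 h2
    have s10 := hswap (e 1) (e 0)
    have s20 := hswap (e 2) (e 0)
    have s21 := hswap (e 2) (e 1)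
    simp only [AlternatingMap.smul_apply, AlternatingMap.curryLeft_apply_apply,
      ContinuousAlternatingMap.coe_toAlternatingMap, smul_eq_mul]
    rw [hvol]
    generalize v 0 = i
    generalize v 1 = j
    fin_cases i <;> fin_cases j <;>
      simp only [Fin.zero_eta, Fin.mk_one, Fin.reduceFinMk, he, e01, e02, e10, e12, e20, e21, hzero]
    · ring
    · linear_combination (-ε) * h2 + (ε ^ 2 / 2) * s10 - β ![e 0, e 1] * hε
    · linear_combination ε * h1 + (ε ^ 2 / 2) * s20 - β ![e 0, e 2] * hε
    · linear_combination ε * h2 + (1 - ε ^ 2 / 2) * s10 + β ![e 0, e 1] * hε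
    · ring
    · linear_combination (-ε) * h0 + (ε ^ 2 / 2) * s21 - β ![e 1, e 2] * hε
    · linear_combination (-ε) * h1 + (1 - ε ^ 2 / 2) * s20 + β ![e 0, e 2] * hε
    · linear_combination ε * h0 + (1 - ε ^ 2 / 2) * s21 + β ![e 1, e 2] * hε
    · ring
  have := congrArg (fun f ↦ f ![a, b]) hext
  simpa using this

end Pointwise

namespace KillingBeltrami

/-! ### The Levi-Civita connection in a coordinate domain -/

section CoordinateCalculus

variable {E : Type*} [NormedAddCommGroup E] [NormedSpace ℝ E]

/-- `G` is a Riemannian metric on the set `T`, which is relatively open in the coordinate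
half-space `s`. Derivatives are taken within `s`. -/
structure IsMetricOn (s T : Set E) (G : E → E →L[ℝ] E →L[ℝ] ℝ) : Prop where
  uniqueDiffOn : UniqueDiffOn ℝ s
  subset_closure : s ⊆ closure (interior s)
  subset : T ⊆ s
  mem_nhdsWithin : ∀ y ∈ T, T ∈ 𝓝[s] y
  smooth : ∀ y ∈ T, ContDiffWithinAt ℝ ∞ G s y
  symm : ∀ y u v, G y u v = G y v u
  pos : ∀ y ∈ T, ∀ u, u ≠ 0 → 0 < G y u u

/-- The Christoffel symbols as a continuous bilinear map. -/
noncomputable def christoffelCLM (s : Set E) (G : E → E →L[ℝ] E →L[ℝ] ℝ) (y : E) :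
    E →L[ℝ] E →L[ℝ] E :=
  (ContinuousLinearMap.compL ℝ E (E →L[ℝ] ℝ) E (G y).inverse) ∘L
    ((1 / 2 : ℝ) • (fderivWithin ℝ G s y + (fderivWithin ℝ G s y).flip
      - (ContinuousLinearMap.flipₗᵢ ℝ E E ℝ).toContinuousLinearEquiv.toContinuousLinearMap ∘L
          (fderivWithin ℝ G s y).flip))

lemma christoffelCLM_apply (s : Set E) (G : E → E →L[ℝ] E →L[ℝ] ℝ) (y u v : E) :
    christoffelCLM s G y u v = christoffel s G y u v := rfl

variable {s T : Set E} {G : E → E →L[ℝ] E →L[ℝ] ℝ} {y : E}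

lemma covDeriv_const (w y u : E) :
    covDeriv s G (fun _ ↦ w) y u = christoffel s G y u w := by
  simp [covDeriv]

namespace IsMetricOn

section

variable (h : IsMetricOn s T G)
include h

lemma fderivWithin_symm (hy : y ∈ T) (u v w : E) :
    fderivWithin ℝ G s y u v w = fderivWithin ℝ G s y u w v := by
  have hG : DifferentiableWithinAt ℝ G s y := (h.smooth y hy).differentiableWithinAt (by simp)
  have hu := h.uniqueDiffOn y (h.subset hy)
  have key : ∀ v w, fderivWithin ℝ (fun z ↦ G z v w) s y u = fderivWithin ℝ G s y u v w := by
    intro v w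
    have := ((hG.hasFDerivWithinAt.clm_apply (hasFDerivWithinAt_const v y s)).clm_apply
      (hasFDerivWithinAt_const w y s)).fderivWithin hu
    rw [this]
    simp
  rw [← key, ← key]
  congr 2
  ext z
  exact h.symm z v w

lemma christoffel_symm (hy : y ∈ T) (u v : E) :
    christoffel s G y u v = christoffel s G y v u := by
  have : ((fderivWithin ℝ G s y).flip u).flip v = ((fderivWithin ℝ G s y).flip v).flip u := by
    ext w
    exact h.fderivWithin_symm hy w u v
  rw [christoffel, christoffel, this, add_comm (fderivWithin ℝ G s y u v)]

lemma gram_pos (hy : y ∈ T) {u v : E} (huv : LinearIndependent ℝ ![u, v]) :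
    0 < G y u u * G y v v - G y u v ^ 2 := by
  have hv : v ≠ 0 := huv.ne_zero 1
  have hw : G y v v • u - G y u v • v ≠ 0 := by
    intro h0
    have := (LinearIndependent.pair_iff.1 huv) (G y v v) (-G y u v)
      (by rw [neg_smul, ← sub_eq_add_neg]; exact h0)
    exact (h.pos y hy v hv).ne' this.1
  have hpos := h.pos y hy _ hw
  simp only [map_sub, map_smul, sub_apply, smul_apply,
    smul_eq_mul] at hpos
  rw [h.symm y v u] at hpos
  refine pos_of_mul_pos_right (a := G y v v) ?_ (h.pos y hy v hv).le
  linarith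

variable [FiniteDimensional ℝ E]

lemma isInvertible (hy : y ∈ T) : (G y).IsInvertible := by
  have hinj : Function.Injective (G y : E →ₗ[ℝ] E →L[ℝ] ℝ) := by
    rw [injective_iff_map_eq_zero]
    intro u hu
    by_contra hne
    have := h.pos y hy u hne
    rw [show G y u = 0 from hu] at this
    simp at this
  have hd : finrank ℝ E = finrank ℝ (E →L[ℝ] ℝ) := by
    rw [← (LinearMap.toContinuousLinearMap (𝕜 := ℝ) (E := E) (F' := ℝ)).finrank_eq]
    exact Subspace.dual_finrank_eq.symm
  exact ⟨(LinearEquiv.ofInjectiveOfFinrankEq (G y : E →ₗ[ℝ] E →L[ℝ] ℝ) hinj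
    hd).toContinuousLinearEquiv, rfl⟩

lemma metric_christoffel (hy : y ∈ T) (u v w : E) :
    G y (christoffel s G y u v) w = 1 / 2 * (fderivWithin ℝ G s y u v w
      + fderivWithin ℝ G s y v u w - fderivWithin ℝ G s y w u v) := by
  rw [christoffel, (h.isInvertible hy).self_apply_inverse]
  simp

/-- The Levi-Civita connection preserves the metric. -/
lemma fderivWithin_metric (hy : y ∈ T) {A B : E → E} (hA : DifferentiableWithinAt ℝ A s y)
    (hB : DifferentiableWithinAt ℝ B s y) (u : E) :
    fderivWithin ℝ (fun z ↦ G z (A z) (B z)) s y u =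
      G y (covDeriv s G A y u) (B y) + G y (A y) (covDeriv s G B y u) := by
  have hG : DifferentiableWithinAt ℝ G s y := (h.smooth y hy).differentiableWithinAt (by simp)
  rw [((hG.hasFDerivWithinAt.clm_apply hA.hasFDerivWithinAt).clm_apply
    hB.hasFDerivWithinAt).fderivWithin (h.uniqueDiffOn y (h.subset hy))]
  have h1 := h.metric_christoffel hy u (A y) (B y)
  have h2 := h.metric_christoffel hy u (B y) (A y)
  rw [h.symm] at h2
  simp only [covDeriv, map_add, add_apply, h1, h2]
  rw [h.fderivWithin_symm hy u (B y) (A y), h.fderivWithin_symm hy (A y) u (B y),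
    h.fderivWithin_symm hy (B y) u (A y)]
  simp
  ring

lemma differentiableWithinAt_christoffelCLM (hy : y ∈ T) :
    DifferentiableWithinAt ℝ (christoffelCLM s G) s y := by
  have hG := h.smooth y hy
  have hD : ContDiffWithinAt ℝ 1 (fderivWithin ℝ G s) s y :=
    hG.fderivWithin_right h.uniqueDiffOn (by norm_cast) (h.subset hy)
  have hinv : ContDiffWithinAt ℝ 1 (fun z ↦ (G z).inverse) s y :=
    ((h.isInvertible hy).contDiffAt_map_inverse (n := 1)).comp_contDiffWithinAt y
      (hG.of_le (by norm_cast))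
  have hflip : ContDiffWithinAt ℝ 1 (fun z ↦ (fderivWithin ℝ G s z).flip) s y :=
    (ContinuousLinearMap.flipₗᵢ ℝ E E (E →L[ℝ] ℝ)).contDiff.comp_contDiffWithinAt hD
  refine ContDiffWithinAt.differentiableWithinAt (n := 1) ?_ (by simp)
  refine ContDiffWithinAt.clm_comp ?_ (((hD.add hflip).sub
    (contDiffWithinAt_const.clm_comp hflip)).const_smul (1 / 2 : ℝ))
  exact (ContinuousLinearMap.compL ℝ E (E →L[ℝ] ℝ) E).contDiff.comp_contDiffWithinAt hinv

lemma differentiableWithinAt_christoffel (hy : y ∈ T) {A : E → E}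
    (hA : DifferentiableWithinAt ℝ A s y) (v : E) :
    DifferentiableWithinAt ℝ (fun z ↦ christoffel s G z v (A z)) s y :=
  ((h.differentiableWithinAt_christoffelCLM hy).clm_apply
    (differentiableWithinAt_const v)).clm_apply hA

lemma fderivWithin_christoffel (hy : y ∈ T) {A : E → E} (hA : DifferentiableWithinAt ℝ A s y)
    (u v : E) :
    fderivWithin ℝ (fun z ↦ christoffel s G z v (A z)) s y u =
      fderivWithin ℝ (christoffelCLM s G) s y u v (A y)
        + christoffel s G y v (fderivWithin ℝ A s y u) := by
  have := (((h.differentiableWithinAt_christoffelCLM hy).hasFDerivWithinAt.clm_apply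
    (hasFDerivWithinAt_const v y s)).clm_apply hA.hasFDerivWithinAt).fderivWithin
    (h.uniqueDiffOn y (h.subset hy))
  simp only [christoffelCLM_apply] at this
  rw [this]
  simp [christoffelCLM_apply, add_comm]

/-! ### Symmetries of the curvature -/

lemma riemann_eq (hy : y ∈ T) (u v w : E) :
    riemann s G y u v w =
      fderivWithin ℝ (christoffelCLM s G) s y u v w
        + christoffelCLM s G y u (christoffelCLM s G y v w)
        - (fderivWithin ℝ (christoffelCLM s G) s y v u w
        + christoffelCLM s G y v (christoffelCLM s G y u w)) := by
  have key := fun u v ↦ h.fderivWithin_christoffel hy (differentiableWithinAt_const w) u v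
  simp only [riemann, covDeriv, key]
  simp [← christoffelCLM_apply]

/-- The curvature operator `R(u, v)` is skew. It is the commutator of the second derivatives of
the function `G(w, w)`, for a constant vector field `w`. -/
lemma metric_riemann_self (hy : y ∈ T) (u v w : E) : G y (riemann s G y u v w) w = 0 := by
  set f : E → ℝ := fun z ↦ G z w w with hf
  have hfs : ContDiffWithinAt ℝ ∞ f s y :=
    ((h.smooth y hy).clm_apply contDiffWithinAt_const).clm_apply contDiffWithinAt_const
  have hsymm : fderivWithin ℝ (fderivWithin ℝ f s) s y u v =
      fderivWithin ℝ (fderivWithin ℝ f s) s y v u :=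
    hfs.isSymmSndFDerivWithinAt (by simp; norm_cast) h.uniqueDiffOn
      (h.subset_closure (h.subset hy)) (h.subset hy) u v
  have hD : DifferentiableWithinAt ℝ (fderivWithin ℝ f s) s y :=
    (hfs.fderivWithin_right (m := 1) h.uniqueDiffOn (by norm_cast)
      (h.subset hy)).differentiableWithinAt (by simp)
  have hu := h.uniqueDiffOn y (h.subset hy)
  have key : ∀ u v, fderivWithin ℝ (fderivWithin ℝ f s) s y u v =
      2 * (G y (covDeriv s G (fun z ↦ christoffel s G z v w) y u) w
        + G y (christoffel s G y v w) (christoffel s G y u w)) := by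
    intro u v
    have h1 : fderivWithin ℝ (fun z ↦ fderivWithin ℝ f s z v) s y u =
        fderivWithin ℝ (fderivWithin ℝ f s) s y u v := by
      rw [(hD.hasFDerivWithinAt.clm_apply (hasFDerivWithinAt_const v y s)).fderivWithin hu]
      simp
    have h2 : (fun z ↦ fderivWithin ℝ f s z v) =ᶠ[𝓝[s] y]
        fun z ↦ 2 * G z (christoffel s G z v w) w := by
      filter_upwards [h.mem_nhdsWithin y hy] with z hz
      rw [hf, h.fderivWithin_metric hz (differentiableWithinAt_const w)
        (differentiableWithinAt_const w), covDeriv_const, h.symm z w]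
      ring
    have hΓ := h.differentiableWithinAt_christoffel hy (differentiableWithinAt_const w) v
    have hGd : DifferentiableWithinAt ℝ (fun z ↦ G z (christoffel s G z v w) w) s y :=
      (((h.smooth y hy).differentiableWithinAt (by simp)).clm_apply hΓ).clm_apply
        (differentiableWithinAt_const w)
    rw [← h1, h2.fderivWithin_eq_of_mem (h.subset hy), fderivWithin_const_mul hu hGd,
      smul_apply, h.fderivWithin_metric hy hΓ
        (differentiableWithinAt_const w), covDeriv_const, smul_eq_mul]
  rw [key, key, h.symm y (christoffel s G y u w)] at hsymm
  rw [riemann, map_sub, sub_apply]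
  linarith

/-- The quadratic form `G(R(u, v) v, u)` only depends on `u ∧ v`. -/
lemma metric_riemann_change_basis (hy : y ∈ T) (u v : E) (c d : ℝ) :
    G y (riemann s G y (-d • u + c • v) (c • u + d • v) (c • u + d • v)) (-d • u + c • v) =
      (c ^ 2 + d ^ 2) ^ 2 * G y (riemann s G y u v v) u := by
  have hR : ∀ w, riemann s G y (-d • u + c • v) (c • u + d • v) w =
      -(c ^ 2 + d ^ 2) • riemann s G y u v w := by
    intro w
    simp only [h.riemann_eq hy, map_add, map_smul, add_apply,
      smul_apply]
    module
  have hlin : riemann s G y u v (c • u + d • v) =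
      c • riemann s G y u v u + d • riemann s G y u v v := by
    simp only [h.riemann_eq hy, map_add, map_smul]
    module
  have huv := h.metric_riemann_self hy u v (u + v)
  have hadd : riemann s G y u v (u + v) = riemann s G y u v u + riemann s G y u v v := by
    simp only [h.riemann_eq hy, map_add]
    module
  have hu := h.metric_riemann_self hy u v u
  have hv := h.metric_riemann_self hy u v v
  rw [hadd] at huv
  simp only [map_add, add_apply] at huv
  rw [hR, hlin]
  simp only [map_add, map_smul, add_apply, smul_apply,
    smul_eq_mul]
  linear_combination (-(c ^ 2 + d ^ 2) * c ^ 2) * huv + (c ^ 2 + d ^ 2) * (c ^ 2 + c * d) * hu +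
    (c ^ 2 + d ^ 2) * (c ^ 2 - c * d) * hv

end

end IsMetricOn

end CoordinateCalculus

/-! ### Killing fields that are eigenfields of the curl, in coordinates -/

section CoordinateFields

variable {E : Type*} [NormedAddCommGroup E] [NormedSpace ℝ E]
  {s T : Set E} {G : E → E →L[ℝ] E →L[ℝ] ℝ} {vol : E → E [⋀^Fin 3]→ₗ[ℝ] ℝ} {c : ℝ} {y : E}

/-- The 3-form `vol` is, up to sign, the volume form of `G` on `T`. This is encoded as Lagrange's
identity `|n|² = k² (|a|² |b|² - ⟨a, b⟩²)` for the vector `n = k (a × b)`, that is the one with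
`⟨n, ·⟩ = k vol(a, b, ·)`. The sign may depend on the point: no continuity is required. -/
def IsVolumeOn (T : Set E) (G : E → E →L[ℝ] E →L[ℝ] ℝ) (vol : E → E [⋀^Fin 3]→ₗ[ℝ] ℝ) : Prop :=
  ∀ y ∈ T, ∀ (k : ℝ) (a b n : E), (∀ v, G y n v = k * vol y ![a, b, v]) →
    G y n n = k ^ 2 * (G y a a * G y b b - G y a b ^ 2)

/-- The smooth vector field `V` satisfies `∇_u V = c V × u` on `T`, where `×` is the cross product
given by `G` and `vol`. -/
structure IsCrossField (s T : Set E) (G : E → E →L[ℝ] E →L[ℝ] ℝ) (vol : E → E [⋀^Fin 3]→ₗ[ℝ] ℝ)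
    (c : ℝ) (V : E → E) : Prop where
  smooth : ∀ y ∈ T, ContDiffWithinAt ℝ ∞ V s y
  metric_covDeriv : ∀ y ∈ T, ∀ u w, G y (covDeriv s G V y u) w = c * vol y ![V y, u, w]

lemma alternating_self_left (f : E [⋀^Fin 3]→ₗ[ℝ] ℝ) (a b : E) : f ![a, a, b] = 0 :=
  f.map_eq_zero_of_eq _ (i := 0) (j := 1) (by simp) (by decide)

lemma alternating_self_right (f : E [⋀^Fin 3]→ₗ[ℝ] ℝ) (a b : E) : f ![a, b, b] = 0 :=
  f.map_eq_zero_of_eq _ (i := 1) (j := 2) (by simp) (by decide)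

lemma alternating_swap_right (f : E [⋀^Fin 3]→ₗ[ℝ] ℝ) (a b b' : E) :
    f ![a, b, b'] = -f ![a, b', b] := by
  have := f.map_swap ![a, b', b] (i := 1) (j := 2) (by decide)
  rw [← this]
  congr 1
  ext i; fin_cases i <;> rfl

lemma alternating_swap_outer (f : E [⋀^Fin 3]→ₗ[ℝ] ℝ) (a b b' : E) :
    f ![a, b, b'] = -f ![b', b, a] := by
  have := f.map_swap ![b', b, a] (i := 0) (j := 2) (by decide)
  rw [← this]
  congr 1
  ext i; fin_cases i <;> rfl

lemma alternating_linear_left (f : E [⋀^Fin 3]→ₗ[ℝ] ℝ) (r t : ℝ) (a a' b b' : E) :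
    f ![r • a + t • a', b, b'] = r * f ![a, b, b'] + t * f ![a', b, b'] := by
  rw [f.map_vecCons_add, f.map_vecCons_smul, f.map_vecCons_smul, smul_eq_mul, smul_eq_mul]

namespace IsCrossField

variable {V W : E → E}

lemma differentiableWithinAt (hV : IsCrossField s T G vol c V) (hy : y ∈ T) :
    DifferentiableWithinAt ℝ V s y :=
  (hV.smooth y hy).differentiableWithinAt (by simp)

lemma covDeriv_eq (V : E → E) (y u : E) :
    covDeriv s G V y u = fderivWithin ℝ V s y u + christoffelCLM s G y u (V y) := rfl

section Metric

variable (h : IsMetricOn s T G)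
include h

lemma eq_zero_of_metric_eq_zero (hy : y ∈ T) {a : E} (ha : ∀ v, G y a v = 0) : a = 0 := by
  by_contra hne
  exact (h.pos y hy a hne).ne' (ha a)

/-- The integral curves of `V` are geodesics. -/
lemma covDeriv_self (hV : IsCrossField s T G vol c V) (hy : y ∈ T) :
    covDeriv s G V y (V y) = 0 :=
  eq_zero_of_metric_eq_zero h hy fun v ↦ by
    rw [hV.metric_covDeriv y hy, alternating_self_left, mul_zero]

lemma linear_combination (hV : IsCrossField s T G vol c V) (hW : IsCrossField s T G vol c W)
    (a b : ℝ) : IsCrossField s T G vol c (fun z ↦ a • V z + b • W z) where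
  smooth y hy := ((hV.smooth y hy).const_smul a).add ((hW.smooth y hy).const_smul b)
  metric_covDeriv y hy u w := by
    have hd : fderivWithin ℝ (fun z ↦ a • V z + b • W z) s y u =
        a • fderivWithin ℝ V s y u + b • fderivWithin ℝ W s y u := by
      have := (((hV.differentiableWithinAt hy).hasFDerivWithinAt.const_smul a).add
        ((hW.differentiableWithinAt hy).hasFDerivWithinAt.const_smul b)).fderivWithin
        (h.uniqueDiffOn y (h.subset hy))
      exact congrArg (fun L ↦ L u) this
    have hcov : covDeriv s G (fun z ↦ a • V z + b • W z) y u =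
        a • covDeriv s G V y u + b • covDeriv s G W y u := by
      simp only [covDeriv_eq, hd, map_add, map_smul]
      module
    rw [hcov, alternating_linear_left]
    simp only [map_add, map_smul, add_apply, smul_apply, smul_eq_mul, hV.metric_covDeriv y hy,
      hW.metric_covDeriv y hy]
    ring

variable [FiniteDimensional ℝ E]

/-- The inner products of cross fields are constant. -/
lemma fderivWithin_metric_eq_zero (hV : IsCrossField s T G vol c V)
    (hW : IsCrossField s T G vol c W) (hy : y ∈ T) :
    fderivWithin ℝ (fun z ↦ G z (V z) (W z)) s y = 0 := by
  ext u
  rw [h.fderivWithin_metric hy (hV.differentiableWithinAt hy) (hW.differentiableWithinAt hy),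
    h.symm y (V y), hV.metric_covDeriv y hy, hW.metric_covDeriv y hy,
    alternating_swap_outer (vol y) (V y)]
  simp

/-- The curvature of the planes containing `V`, computed as the commutator of the second covariant
derivatives of `V`. -/
lemma metric_riemann_eq_metric_covDeriv (hV : IsCrossField s T G vol c V) (hy : y ∈ T) (u : E) :
    G y (riemann s G y u (V y) (V y)) u = G y (covDeriv s G V y u) (covDeriv s G V y u) := by
  have hu := h.uniqueDiffOn y (h.subset hy)
  have hVd := hV.differentiableWithinAt hy
  have hΓd := h.differentiableWithinAt_christoffelCLM hy
  have hDd : DifferentiableWithinAt ℝ (fderivWithin ℝ V s) s y :=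
    ((hV.smooth y hy).fderivWithin_right (m := 1) h.uniqueDiffOn (by norm_cast)
      (h.subset hy)).differentiableWithinAt (by simp)
  have hsymm : ∀ a b, fderivWithin ℝ (fderivWithin ℝ V s) s y a b =
      fderivWithin ℝ (fderivWithin ℝ V s) s y b a := fun a b ↦
    (hV.smooth y hy).isSymmSndFDerivWithinAt (by simp; norm_cast) h.uniqueDiffOn
      (h.subset_closure (h.subset hy)) (h.subset hy) a b
  have hN : ∀ v, DifferentiableWithinAt ℝ (fun z ↦ covDeriv s G V z v) s y := fun v ↦
    (hDd.clm_apply (differentiableWithinAt_const v)).add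
      (h.differentiableWithinAt_christoffel hy hVd v)
  -- derivative of `z ↦ ∇_{X(z)} V` for a vector field `X`
  have hcov : ∀ {X : E → E}, DifferentiableWithinAt ℝ X s y → ∀ a,
      fderivWithin ℝ (fun z ↦ covDeriv s G V z (X z)) s y a =
        fderivWithin ℝ (fderivWithin ℝ V s) s y a (X y)
        + fderivWithin ℝ (christoffelCLM s G) s y a (X y) (V y)
        + christoffelCLM s G y (X y) (fderivWithin ℝ V s y a)
        + covDeriv s G V y (fderivWithin ℝ X s y a) := by
    intro X hX a
    have := ((hDd.hasFDerivWithinAt.clm_apply hX.hasFDerivWithinAt).add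
      ((hΓd.hasFDerivWithinAt.clm_apply hX.hasFDerivWithinAt).clm_apply
        hVd.hasFDerivWithinAt)).fderivWithin hu
    refine (congrArg (fun L ↦ L a) this).trans ?_
    simp only [covDeriv_eq, add_apply, ContinuousLinearMap.comp_apply,
      ContinuousLinearMap.flip_apply]
    abel
  -- differentiating the Killing equation `G(∇_u V, u) = 0` along `V`
  have hkilling : G y (covDeriv s G (fun z ↦ covDeriv s G V z u) y (V y)) u
      + G y (covDeriv s G V y u) (christoffelCLM s G y (V y) u) = 0 := by
    have h0 : (fun z ↦ G z (covDeriv s G V z u) u) =ᶠ[𝓝[s] y] fun _ ↦ 0 := by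
      filter_upwards [h.mem_nhdsWithin y hy] with z hz
      rw [hV.metric_covDeriv z hz, alternating_self_right, mul_zero]
    have := h.fderivWithin_metric hy (hN u) (differentiableWithinAt_const u) (V y)
    rw [h0.fderivWithin_eq_of_mem (h.subset hy), covDeriv_const] at this
    rw [christoffelCLM_apply, ← this]
    simp
  -- differentiating `∇_V V = 0` along `u`
  have hgeod : fderivWithin ℝ (fun z ↦ covDeriv s G V z (V z)) s y u = 0 := by
    have h0 : (fun z ↦ covDeriv s G V z (V z)) =ᶠ[𝓝[s] y] fun _ ↦ 0 := by
      filter_upwards [h.mem_nhdsWithin y hy] with z hz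
      exact hV.covDeriv_self h hz
    rw [h0.fderivWithin_eq_of_mem (h.subset hy)]
    simp
  have hskew : ∀ a b, G y (covDeriv s G V y a) b = -G y (covDeriv s G V y b) a := by
    intro a b
    rw [hV.metric_covDeriv y hy, hV.metric_covDeriv y hy, alternating_swap_right]
    ring
  rw [hcov hVd] at hgeod
  have hself := hV.covDeriv_self h hy
  have hΓsymm : ∀ a b, christoffelCLM s G y a b = christoffelCLM s G y b a :=
    fun a b ↦ h.christoffel_symm hy a b
  set N := covDeriv s G V y u with hNdef
  have hDV : fderivWithin ℝ V s y u = N - christoffelCLM s G y u (V y) := by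
    rw [hNdef, covDeriv_eq]; abel
  have hDVV : fderivWithin ℝ V s y (V y) = - christoffelCLM s G y (V y) (V y) := by
    rw [covDeriv_eq] at hself
    exact eq_neg_of_add_eq_zero_left hself
  have hsub : covDeriv s G V y (fderivWithin ℝ V s y u) =
      covDeriv s G V y N - covDeriv s G V y (christoffelCLM s G y u (V y)) := by
    rw [hDV]
    simp only [covDeriv_eq, map_sub, sub_apply]
    abel
  -- the Ricci identity
  have hricci : riemann s G y u (V y) (V y) =
      - covDeriv s G V y (fderivWithin ℝ V s y u)
        - covDeriv s G (fun z ↦ covDeriv s G V z u) y (V y) := by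
    have h1 := hcov (differentiableWithinAt_const u) (V y)
    rw [covDeriv_eq (fun z ↦ covDeriv s G V z u), h1, h.riemann_eq hy]
    have h2 : fderivWithin ℝ (fderivWithin ℝ V s) s y (V y) u =
      - (fderivWithin ℝ (christoffelCLM s G) s y u (V y) (V y)
        + christoffelCLM s G y (V y) (fderivWithin ℝ V s y u)
        + covDeriv s G V y (fderivWithin ℝ V s y u)) := by
      rw [hsymm, ← sub_eq_zero, ← hgeod]
      abel
    have h3 : covDeriv s G V y (fderivWithin ℝ (fun _ : E ↦ u) s y (V y)) = 0 := by
      simp [covDeriv_eq]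
    rw [h2, h3, hDVV, ← hNdef, hDV]
    simp only [map_sub, map_neg]
    abel
  rw [hricci, hsub]
  simp only [map_sub, map_neg, sub_apply, neg_apply]
  rw [hskew N u, hskew _ u, ← hNdef]
  rw [hΓsymm (V y) u] at hkilling
  linear_combination -hkilling

end Metric

variable [FiniteDimensional ℝ E]

lemma metric_riemann (h : IsMetricOn s T G) (hvol : IsVolumeOn T G vol)
    (hV : IsCrossField s T G vol c V) (hy : y ∈ T) (u : E) :
    G y (riemann s G y u (V y) (V y)) u =
      c ^ 2 * (G y (V y) (V y) * G y u u - G y (V y) u ^ 2) := by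
  rw [hV.metric_riemann_eq_metric_covDeriv h hy]
  exact hvol y hy c _ _ _ fun v ↦ hV.metric_covDeriv y hy u v

end IsCrossField

/-- The sectional curvature of every plane is `c ^ 2`, not only that of the planes containing a
value of one of the given fields: every plane in a three-dimensional space meets the plane spanned
by `V y` and `W y`, and a nonzero vector in the intersection is the value of a cross field. -/
lemma sec_eq_of_isCrossField (hE : finrank ℝ E = 3) (h : IsMetricOn s T G)
    (hvol : IsVolumeOn T G vol) {V W : E → E} (hV : IsCrossField s T G vol c V)
    (hW : IsCrossField s T G vol c W) (hy : y ∈ T) (hVW : LinearIndependent ℝ ![V y, W y]) {u v : E}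
    (huv : LinearIndependent ℝ ![u, v]) : sec s G y u v = c ^ 2 := by
  have : FiniteDimensional ℝ E := Module.finite_of_finrank_eq_succ hE
  have hdep : ¬ LinearIndependent ℝ ![u, v, V y, W y] := by
    intro hli
    have := hli.fintype_card_le_finrank
    simp [hE] at this
  obtain ⟨g, hg, i, hi⟩ := Fintype.not_linearIndependent_iff.1 hdep
  simp only [Fin.sum_univ_four, Matrix.cons_val] at hg
  set a := g 0
  set b := g 1
  have hab : a ^ 2 + b ^ 2 ≠ 0 := by
    intro h0
    have ha : a = 0 := by nlinarith [sq_nonneg a, sq_nonneg b]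
    have hb : b = 0 := by nlinarith [sq_nonneg a, sq_nonneg b]
    have h23 := LinearIndependent.pair_iff.1 hVW (g 2) (g 3) (by simpa [ha, hb] using hg)
    fin_cases i
    exacts [hi ha, hi hb, hi h23.1, hi h23.2]
  have hX := hV.linear_combination h hW (-g 2) (-g 3)
  have hval : (-g 2) • V y + (-g 3) • W y = a • u + b • v := by
    rw [← sub_eq_zero, ← neg_eq_zero, ← hg]
    module
  have hsec := hX.metric_riemann h hvol hy (-b • u + a • v)
  simp only [hval] at hsec
  rw [h.metric_riemann_change_basis hy] at hsec
  simp only [map_add, map_smul, add_apply, smul_apply, smul_eq_mul] at hsec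
  rw [h.symm y v u] at hsec
  rw [sec, div_eq_iff (h.gram_pos hy huv).ne']
  refine mul_left_cancel₀ (pow_ne_zero 2 hab) ?_
  rw [hsec]
  ring

end CoordinateFields

/-! ### Passing to a chart -/

section Chart

variable {E : Type*} [NormedAddCommGroup E] [NormedSpace ℝ E]
  {H : Type*} [TopologicalSpace H] {I : ModelWithCorners ℝ E H}
  {M : Type*} [TopologicalSpace M] [ChartedSpace H M] {x₀ : M} {z : E}

lemma target_mem_nhdsWithin_range (hz : z ∈ (extChartAt I x₀).target) :
    (extChartAt I x₀).target ∈ 𝓝[range I] z :=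
  extChartAt_target_mem_nhdsWithin_of_mem hz

section

variable [IsManifold I ∞ M]

lemma isInvertible_chartSymmDeriv (hz : z ∈ (extChartAt I x₀).target) :
    (chartSymmDeriv I x₀ z).IsInvertible :=
  haveI : IsManifold I 1 M := .of_le (n := ∞) (by norm_cast)
  isInvertible_mfderivWithin_extChartAt_symm hz

lemma toCoord_chartSymmDeriv (hz : z ∈ (extChartAt I x₀).target) (u : E) :
    toCoord I x₀ ((extChartAt I x₀).symm z) (chartSymmDeriv I x₀ z u) = u :=
  haveI : IsManifold I 1 M := .of_le (n := ∞) (by norm_cast)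
  congrArg (fun L ↦ L u) (mfderiv_extChartAt_comp_mfderivWithin_extChartAt_symm hz)

lemma chartSymmDeriv_fieldInChart (hz : z ∈ (extChartAt I x₀).target)
    (Y : Π x : M, TangentSpace I x) :
    chartSymmDeriv I x₀ z (fieldInChart I x₀ Y z) = Y ((extChartAt I x₀).symm z) :=
  (isInvertible_chartSymmDeriv hz).self_apply_inverse _

lemma contDiffWithinAt_fieldInChart [FiniteDimensional ℝ E] {Y : Π x : M, TangentSpace I x}
    (hY : ContMDiff I I.tangent ∞ (fun x ↦ (⟨x, Y x⟩ : TangentBundle I M)))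
    (hz : z ∈ (extChartAt I x₀).target) :
    ContDiffWithinAt ℝ ∞ (fieldInChart I x₀ Y) (range I) z := by
  have : CompleteSpace E := FiniteDimensional.complete ℝ E
  have : IsManifold I 1 M := .of_le (n := ∞) (by norm_cast)
  have hinv : (mfderivWithin 𝓘(ℝ, E) I (extChartAt I x₀).symm (range I) z).IsInvertible :=
    isInvertible_mfderivWithin_extChartAt_symm hz
  refine contMDiffWithinAt_vectorSpace_iff_contDiffWithinAt.1 ?_
  exact ContMDiffWithinAt.mpullbackWithin_vectorField_of_mem (n := ∞) (t := univ)
    (hY _).contMDiffWithinAt (contMDiffWithinAt_extChartAt_symm_range x₀ hz)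
    hinv (extChartAt_target_subset_range x₀ hz) I.uniqueMDiffOn (by norm_cast) (by simp)

/-- The coordinate vector fields of a chart are smooth. -/
lemma contMDiffOn_chartSymmDeriv (x₀ : M) (u : E) :
    ContMDiffOn 𝓘(ℝ, E) I.tangent ∞
      (fun z ↦ (⟨(extChartAt I x₀).symm z, chartSymmDeriv I x₀ z u⟩ : TangentBundle I M))
      (extChartAt I x₀).target := by
  have hU : UniqueMDiffOn 𝓘(ℝ, E) (extChartAt I x₀).target :=
    (uniqueDiffOn_extChartAt_target x₀).uniqueMDiffOn
  have h := ContMDiffOn.contMDiffOn_tangentMapWithin (m := ∞)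
    (contMDiffOn_extChartAt_symm (I := I) (n := ∞) x₀) (by norm_cast) hU
  have hu : ContMDiffOn 𝓘(ℝ, E) 𝓘(ℝ, E).tangent ∞
      (fun z ↦ (⟨z, u⟩ : TangentBundle 𝓘(ℝ, E) E)) (extChartAt I x₀).target :=
    contMDiffOn_vectorSpace_iff_contDiffOn.2 contDiffOn_const
  refine (h.comp hu fun z hz ↦ hz).congr fun z hz ↦ ?_
  have : mfderivWithin 𝓘(ℝ, E) I (extChartAt I x₀).symm (range I) z =
      mfderivWithin 𝓘(ℝ, E) I (extChartAt I x₀).symm (extChartAt I x₀).target z :=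
    (mfderivWithin_subset (extChartAt_target_subset_range x₀) (hU z hz)
      ((contMDiffWithinAt_extChartAt_symm_range (n := ∞) x₀ hz).mdifferentiableWithinAt
        (by simp))).symm
  simp only [chartSymmDeriv, this]
  rfl

end

section Metric

variable [Bundle.RiemannianBundle (fun x : M ↦ TangentSpace I x)]

lemma metricInChart_apply (x₀ : M) (z u v : E) :
    metricInChart I x₀ z u v =
      inner ℝ (chartSymmDeriv I x₀ z u) (chartSymmDeriv I x₀ z v) := rfl

/-- The Riemannian volume form in the chart at `x₀`. -/
noncomputable def volumeInChart [Fact (finrank ℝ E = 3)]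
    (o : Π x : M, Orientation ℝ (TangentSpace I x) (Fin 3)) (x₀ : M) (z : E) : E [⋀^Fin 3]→ₗ[ℝ] ℝ :=
  (o ((extChartAt I x₀).symm z)).volumeForm.compLinearMap (chartSymmDeriv I x₀ z).toLinearMap

lemma volumeInChart_apply [Fact (finrank ℝ E = 3)]
    (o : Π x : M, Orientation ℝ (TangentSpace I x) (Fin 3)) (x₀ : M) (z a b c : E) :
    volumeInChart o x₀ z ![a, b, c] = (o ((extChartAt I x₀).symm z)).volumeForm
      ![chartSymmDeriv I x₀ z a, chartSymmDeriv I x₀ z b, chartSymmDeriv I x₀ z c] := by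
  rw [volumeInChart, AlternatingMap.compLinearMap_apply]
  congr 1
  ext i; fin_cases i <;> rfl

variable [IsManifold I ∞ M]

lemma metricInChart_fieldInChart (hz : z ∈ (extChartAt I x₀).target)
    (Y Z : Π x : M, TangentSpace I x) :
    metricInChart I x₀ z (fieldInChart I x₀ Y z) (fieldInChart I x₀ Z z) =
      inner ℝ (Y ((extChartAt I x₀).symm z)) (Z ((extChartAt I x₀).symm z)) := by
  rw [metricInChart_apply, chartSymmDeriv_fieldInChart hz, chartSymmDeriv_fieldInChart hz]

lemma isMetricOn_metricInChart [FiniteDimensional ℝ E]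
    [IsContMDiffRiemannianBundle I ∞ E (fun x : M ↦ TangentSpace I x)] (x₀ : M) :
    IsMetricOn (range I) (extChartAt I x₀).target (metricInChart I x₀) where
  uniqueDiffOn := I.uniqueDiffOn
  subset_closure := I.range_subset_closure_interior
  subset := extChartAt_target_subset_range x₀
  mem_nhdsWithin _ := target_mem_nhdsWithin_range
  smooth := by
    suffices ContDiffOn ℝ ∞ (metricInChart I x₀) (extChartAt I x₀).target from fun y hy ↦
      (this y hy).mono_of_mem_nhdsWithin (target_mem_nhdsWithin_range hy)
    rw [contDiffOn_clm_apply]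
    intro u
    rw [contDiffOn_clm_apply]
    intro v
    rw [← contMDiffOn_iff_contDiffOn]
    exact ContMDiffOn.inner_bundle (IB := I) (F := E) (E := fun x : M ↦ TangentSpace I x)
      (b := (extChartAt I x₀).symm) (v := fun z ↦ chartSymmDeriv I x₀ z u)
      (w := fun z ↦ chartSymmDeriv I x₀ z v)
      (contMDiffOn_chartSymmDeriv x₀ u) (contMDiffOn_chartSymmDeriv x₀ v)
  symm z u v := by
    rw [metricInChart_apply, metricInChart_apply, real_inner_comm]
  pos z hz u hu := by
    rw [metricInChart_apply, real_inner_self_pos]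
    intro h0
    exact hu ((isInvertible_chartSymmDeriv hz).bijective.1 (by rw [h0, map_zero]))

/-- For a Killing field `Y` the exterior derivative of `Y♭` is `2 g(∇Y, ·)`. -/
lemma extDerivWithin_flatInChart [FiniteDimensional ℝ E]
    [IsContMDiffRiemannianBundle I ∞ E (fun x : M ↦ TangentSpace I x)]
    {Y : Π x : M, TangentSpace I x}
    (hY : ContMDiff I I.tangent ∞ (fun x ↦ (⟨x, Y x⟩ : TangentBundle I M)))
    (hK : IsKilling I Y) (hz : z ∈ (extChartAt I x₀).target) (u w : E) :
    extDerivWithin (flatInChart I x₀ Y) (range I) z ![u, w] =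
      2 * metricInChart I x₀ z
        (covDeriv (range I) (metricInChart I x₀) (fieldInChart I x₀ Y) z u) w := by
  have h := isMetricOn_metricInChart (I := I) x₀
  have hu := h.uniqueDiffOn z (h.subset hz)
  have hVd : DifferentiableWithinAt ℝ (fieldInChart I x₀ Y) (range I) z :=
    (contDiffWithinAt_fieldInChart hY hz).differentiableWithinAt (by simp)
  have hGV : DifferentiableWithinAt ℝ
      (fun z ↦ metricInChart I x₀ z (fieldInChart I x₀ Y z)) (range I) z :=
    ((h.smooth z hz).differentiableWithinAt (by simp)).clm_apply hVd
  have hflat : DifferentiableWithinAt ℝ (flatInChart I x₀ Y) (range I) z :=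
    (ContinuousAlternatingMap.ofSubsingletonLIE (𝕜 := ℝ) (E := E) (F := ℝ)
      (0 : Fin 1)).differentiable.differentiableAt.comp_differentiableWithinAt z hGV
  have hval : ∀ a b : E,
      fderivWithin ℝ (fun z ↦ metricInChart I x₀ z (fieldInChart I x₀ Y z) b) (range I) z a =
      metricInChart I x₀ z
        (covDeriv (range I) (metricInChart I x₀) (fieldInChart I x₀ Y) z a) b +
      metricInChart I x₀ z (fieldInChart I x₀ Y z)
        (christoffel (range I) (metricInChart I x₀) z a b) := by
    intro a b
    have := h.fderivWithin_metric hz hVd (differentiableWithinAt_const b) a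
    rwa [covDeriv_const] at this
  have hkill : ∀ a b, metricInChart I x₀ z
        (covDeriv (range I) (metricInChart I x₀) (fieldInChart I x₀ Y) z a) b =
      - metricInChart I x₀ z
        (covDeriv (range I) (metricInChart I x₀) (fieldInChart I x₀ Y) z b) a := by
    intro a b
    have := hK x₀ ((extChartAt I x₀).symm z)
      (by simpa using (extChartAt I x₀).map_target hz) a b
    simp only [(extChartAt I x₀).right_inv hz] at this
    rw [h.symm z a] at this
    exact eq_neg_of_add_eq_zero_left this
  have hflat_apply : ∀ (v : Fin 1 → E), (fun z ↦ flatInChart I x₀ Y z v) =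
    fun z ↦ metricInChart I x₀ z (fieldInChart I x₀ Y z) (v 0) := fun v ↦ rfl
  rw [extDerivWithin_apply hflat hu]
  simp only [hflat_apply, hval, Fin.removeNth]
  simp [hkill w u, h.christoffel_symm hz w u]
  ring

variable [Fact (finrank ℝ E = 3)] (o : Π x : M, Orientation ℝ (TangentSpace I x) (Fin 3))

lemma isVolumeOn_volumeInChart (x₀ : M) :
    IsVolumeOn (extChartAt I x₀).target (metricInChart I x₀) (volumeInChart o x₀) := by
  intro z hz k a b n h
  simp only [metricInChart_apply, volumeInChart_apply] at h ⊢
  refine inner_self_of_inner_eq_volumeForm (o ((extChartAt I x₀).symm z)) fun v ↦ ?_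
  obtain ⟨v, rfl⟩ := (isInvertible_chartSymmDeriv hz).bijective.2 v
  exact h v

/-- A Killing field with `curl Y = l Y` satisfies `∇_u Y = (l / 2) Y × u`. -/
lemma isCrossField_fieldInChart [FiniteDimensional ℝ E]
    [IsContMDiffRiemannianBundle I ∞ E (fun x : M ↦ TangentSpace I x)]
    {Y : Π x : M, TangentSpace I x}
    (hY : ContMDiff I I.tangent ∞ (fun x ↦ (⟨x, Y x⟩ : TangentBundle I M)))
    (hK : IsKilling I Y) {l : ℝ} (hc : IsCurlEigenfield I o Y l) (x₀ : M) :
    IsCrossField (range I) (extChartAt I x₀).target (metricInChart I x₀) (volumeInChart o x₀)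
      (l / 2) (fieldInChart I x₀ Y) where
  smooth _ hz := contDiffWithinAt_fieldInChart hY hz
  metric_covDeriv z hz u w := by
    have h1 := eq_volumeForm_of_sharp_hodgeStar_eq _ _ _ _
      (hc x₀ ((extChartAt I x₀).symm z) (by simpa using (extChartAt I x₀).map_target hz))
      (chartSymmDeriv I x₀ z u) (chartSymmDeriv I x₀ z w)
    have h2 : dFlat I x₀ Y ((extChartAt I x₀).symm z)
        ![chartSymmDeriv I x₀ z u, chartSymmDeriv I x₀ z w] =
        extDerivWithin (flatInChart I x₀ Y) (range I) z ![u, w] := by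
      rw [dFlat, ContinuousAlternatingMap.compContinuousLinearMap_apply,
        (extChartAt I x₀).right_inv hz]
      congr 1
      ext i
      fin_cases i
      exacts [toCoord_chartSymmDeriv hz u, toCoord_chartSymmDeriv hz w]
    rw [volumeInChart_apply, chartSymmDeriv_fieldInChart hz]
    rw [h2, extDerivWithin_flatInChart hY hK hz] at h1
    linarith

end Metric

end Chart

/-! ### Constancy of the inner products -/

section Global

variable {E : Type*} [NormedAddCommGroup E] [NormedSpace ℝ E] [Fact (finrank ℝ E = 3)]
  {H : Type*} [TopologicalSpace H] {I : ModelWithCorners ℝ E H}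
  {M : Type*} [TopologicalSpace M] [ChartedSpace H M] [IsManifold I ∞ M]
  [Bundle.RiemannianBundle (fun x : M ↦ TangentSpace I x)]
  [IsContMDiffRiemannianBundle I ∞ E (fun x : M ↦ TangentSpace I x)]
  {o : Π x : M, Orientation ℝ (TangentSpace I x) (Fin 3)}
  {Y Z : Π x : M, TangentSpace I x} {l : ℝ}

/-- In charts the inner product has vanishing derivative; the coordinate half-space is convex, so
this also works at boundary points. -/
lemma isLocallyConstant_inner
    (hY : ContMDiff I I.tangent ∞ (fun x ↦ (⟨x, Y x⟩ : TangentBundle I M)))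
    (hZ : ContMDiff I I.tangent ∞ (fun x ↦ (⟨x, Z x⟩ : TangentBundle I M)))
    (hKY : IsKilling I Y) (hKZ : IsKilling I Z)
    (hcY : IsCurlEigenfield I o Y l) (hcZ : IsCurlEigenfield I o Z l) :
    IsLocallyConstant (fun x ↦ inner ℝ (Y x) (Z x)) := by
  have : FiniteDimensional ℝ E := .of_fact_finrank_eq_succ 2
  rw [IsLocallyConstant.iff_eventually_eq]
  intro x
  have h := isMetricOn_metricInChart (I := I) x
  have hV := isCrossField_fieldInChart o hY hKY hcY x
  have hW := isCrossField_fieldInChart o hZ hKZ hcZ x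
  set V := fieldInChart I x Y
  set W := fieldInChart I x Z
  set g : E → ℝ := fun z ↦ metricInChart I x z (V z) (W z)
  have hz : extChartAt I x x ∈ (extChartAt I x).target := mem_extChartAt_target x
  -- the chart domain contains a convex neighbourhood, a ball in the coordinate half-space
  obtain ⟨r, hr, hball⟩ := Metric.mem_nhdsWithin_iff.1 (h.mem_nhdsWithin _ hz)
  have hconv : Convex ℝ (range I ∩ Metric.ball (extChartAt I x x) r) :=
    I.convex_range.inter (convex_ball _ _)
  have hsub : ∀ z ∈ range I ∩ Metric.ball (extChartAt I x x) r, z ∈ (extChartAt I x).target :=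
    fun z hz ↦ hball ⟨hz.2, hz.1⟩
  have hconst : ∀ z ∈ range I ∩ Metric.ball (extChartAt I x x) r,
      g z = g (extChartAt I x x) := by
    intro z hzB
    refine hconv.is_const_of_fderivWithin_eq_zero (𝕜 := ℝ) (fun w hw ↦ ?_) (fun w hw ↦ ?_) hzB
      ⟨h.subset hz, Metric.mem_ball_self hr⟩
    · have hw' := hsub w hw
      exact ((((h.smooth w hw').differentiableWithinAt (by simp)).clm_apply
        (hV.differentiableWithinAt hw')).clm_apply
          (hW.differentiableWithinAt hw')).mono inter_subset_left
    · rw [fderivWithin_inter (Metric.isOpen_ball.mem_nhds hw.2)]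
      exact hV.fderivWithin_metric_eq_zero h hW (hsub w hw)
  have hg : ∀ x' ∈ (extChartAt I x).source, g (extChartAt I x x') = inner ℝ (Y x') (Z x') := by
    intro x' hx'
    refine (metricInChart_fieldInChart ((extChartAt I x).map_source hx') Y Z).trans ?_
    exact congrArg (fun x' ↦ inner ℝ (Y x') (Z x')) ((extChartAt I x).left_inv hx')
  filter_upwards [extChartAt_source_mem_nhds (I := I) x,
    (continuousAt_extChartAt (I := I) x).preimage_mem_nhds (Metric.ball_mem_nhds _ hr)]
    with x' h1 h2
  rw [← hg x' h1, ← hg x (mem_extChartAt_source x)]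
  exact hconst _ ⟨h.subset ((extChartAt I x).map_source h1), h2⟩

variable [PreconnectedSpace M]

/-- The Gram matrix of the two fields is constant, so they are independent everywhere as soon as
they are independent at one point. -/
lemma linearIndependent_of_linearIndependent_at
    (hY : ContMDiff I I.tangent ∞ (fun x ↦ (⟨x, Y x⟩ : TangentBundle I M)))
    (hZ : ContMDiff I I.tangent ∞ (fun x ↦ (⟨x, Z x⟩ : TangentBundle I M)))
    (hKY : IsKilling I Y) (hKZ : IsKilling I Z)
    (hcY : IsCurlEigenfield I o Y l) (hcZ : IsCurlEigenfield I o Z l)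
    {p : M} (hp : LinearIndependent ℝ ![Y p, Z p]) (x : M) :
    LinearIndependent ℝ ![Y x, Z x] := by
  have hYY := (isLocallyConstant_inner hY hY hKY hKY hcY hcY).apply_eq_of_preconnectedSpace x p
  have hYZ := (isLocallyConstant_inner hY hZ hKY hKZ hcY hcZ).apply_eq_of_preconnectedSpace x p
  have hZZ := (isLocallyConstant_inner hZ hZ hKZ hKZ hcZ hcZ).apply_eq_of_preconnectedSpace x p
  rw [LinearIndependent.pair_iff] at hp ⊢
  intro a b hab
  refine hp a b ?_
  have hexp : ∀ q : M, inner ℝ (a • Y q + b • Z q) (a • Y q + b • Z q) =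
      a ^ 2 * inner ℝ (Y q) (Y q) + 2 * (a * b) * inner ℝ (Y q) (Z q)
        + b ^ 2 * inner ℝ (Z q) (Z q) := by
    intro q
    simp only [inner_add_left, inner_add_right, real_inner_smul_left, real_inner_smul_right]
    rw [real_inner_comm (Y q) (Z q)]
    ring
  rw [← inner_self_eq_zero (𝕜 := ℝ), hexp, ← hYY, ← hYZ, ← hZZ, ← hexp, hab, inner_zero_left]

end Global

end KillingBeltrami

theorem theorem10 {E : Type*} [NormedAddCommGroup E] [NormedSpace ℝ E]
    [Fact (Module.finrank ℝ E = 3)]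
    {H : Type*} [TopologicalSpace H] (I : ModelWithCorners ℝ E H)
    {M : Type*} [TopologicalSpace M] [T2Space M] [SecondCountableTopology M] [ConnectedSpace M]
    [ChartedSpace H M] [IsManifold I ∞ M]
    [Bundle.RiemannianBundle (fun x : M ↦ TangentSpace I x)]
    [IsContMDiffRiemannianBundle I ∞ E (fun x : M ↦ TangentSpace I x)]
    (o : Π x : M, Orientation ℝ (TangentSpace I x) (Fin 3))
    (ho : KillingBeltrami.IsOrientation I o)
    (Y₁ Y₂ : Π x : M, TangentSpace I x)
    (hY₁ : ContMDiff I I.tangent ∞ (fun x ↦ (⟨x, Y₁ x⟩ : TangentBundle I M)))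
    (hY₂ : ContMDiff I I.tangent ∞ (fun x ↦ (⟨x, Y₂ x⟩ : TangentBundle I M)))
    (hK₁ : KillingBeltrami.IsKilling I Y₁) (hK₂ : KillingBeltrami.IsKilling I Y₂)
    (l : ℝ)
    (hc₁ : KillingBeltrami.IsCurlEigenfield I o Y₁ l)
    (hc₂ : KillingBeltrami.IsCurlEigenfield I o Y₂ l)
    (p : M) (hp : LinearIndependent ℝ ![Y₁ p, Y₂ p]) :
    KillingBeltrami.HasConstantSectionalCurvature I M (l ^ 2 / 4) := by
  open KillingBeltrami in
  have hE : finrank ℝ E = 3 := Fact.out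
  have : FiniteDimensional ℝ E := .of_fact_finrank_eq_succ 2
  have : IsManifold I 1 M := .of_le (n := ∞) (by norm_cast)
  intro x₀ x hx X Z hXZ
  have hxs : x ∈ (extChartAt I x₀).source := by simpa using hx
  have hz := (extChartAt I x₀).map_source hxs
  have hXZ' : LinearIndependent ℝ ![toCoord I x₀ x X, toCoord I x₀ x Z] := by
    have hinj : Function.Injective (toCoord I x₀ x) :=
      (isInvertible_mfderiv_extChartAt hxs).bijective.1
    rw [LinearIndependent.pair_iff] at hXZ ⊢
    intro a b hab
    refine hXZ a b (hinj ?_)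
    rw [map_add, map_smul, map_smul, map_zero, hab]
  have hV : LinearIndependent ℝ ![fieldInChart I x₀ Y₁ (extChartAt I x₀ x),
      fieldInChart I x₀ Y₂ (extChartAt I x₀ x)] := by
    have hind := linearIndependent_of_linearIndependent_at hY₁ hY₂ hK₁ hK₂ hc₁ hc₂ hp
      ((extChartAt I x₀).symm (extChartAt I x₀ x))
    rw [LinearIndependent.pair_iff] at hind ⊢
    intro a b hab
    refine hind a b ?_
    rw [← chartSymmDeriv_fieldInChart hz Y₁, ← chartSymmDeriv_fieldInChart hz Y₂, ← map_smul,
      ← map_smul, ← map_add, hab, map_zero]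
  rw [sectionalCurvature, sec_eq_of_isCrossField hE (isMetricOn_metricInChart x₀)
    (isVolumeOn_volumeInChart o x₀) (isCrossField_fieldInChart o hY₁ hK₁ hc₁ x₀)
    (isCrossField_fieldInChart o hY₂ hK₂ hc₂ x₀) hz hV hXZ']
  ring
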